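/- Let $\mathcal A$ be a unital $C^*$-algebra. A \emph{covariant triple} $(\pi,U,H)$ for $\mathcal A$ consists of a Hilbert space $H$, a faithful non-degenerate $*$-representation $\pi:\mathcal A\to\mathcal B(H)$ and a partial isometry $U\in\mathcal B(H)$. 1. Let $\delta:\mathcal A\to\mathcal A$ be an arbitrary endomorphism (a $*$-preserving algebra homomorphism, not assumed to be unital or injective). Then the $C^*$-dynamical system $(\mathcal A,\delta)$ has a strict covariant representation, that is, there is a covariant triple $(\pi,U,H)$ for $\mathcal A$ such that $$\pi(\delta(a))=U\pi(a)U^*\quad (a\in\mathcal A)\qquad\text{and}\qquad U^*U=1-\operatorname*{s-lim}_{\lambda\in\Lambda}\pi(\mu_\lambda),$$ where $\{\mu_\lambda\}_{\lambda\in\Lambda}$ is an approximate unit (in the closed unit ball) of the ideal $\ker\delta$, the limit is taken in the strong operator topology, and the second equality holds for every such approximate unit. 2. A mapping $\delta:\mathcal A\to\mathcal A$ is an endomorphism of $\mathcal A$ if and only if there exists a covariant triple $(\pi,U,H)$ for $\mathcal A$ satisfying $$\text{(CR1)}\quad U\pi(a)=\pi(\delta(a))U\quad (a\in\mathcal A),\qquad\qquad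 \text{(CR2)}\quad \pi(\delta(a))=U\pi(a)U^*\quad (a\in\mathcal A).$$ -/

import Mathlib

universe u v

open Filter Topology

noncomputable section

/-- A partial isometry on a Hilbert space (here `star U` is the adjoint of `U`). -/
def IsPartialIsometry {H : Type v} [NormedAddCommGroup H] [InnerProductSpace ℂ H]
    [CompleteSpace H] (U : H →L[ℂ] H) : Prop :=
  U * star U * U = U

/-- A covariant triple `(π, U, H)` for a unital C*-algebra `A`: a faithful non-degenerate
*-representation `π` of `A` on the Hilbert space `H` and a partial isometry `U` on `H`. -/
structure CovariantTriple (A : Type u) [CStarAlgebra A] (H : Type v) [NormedAddCommGroup H]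
    [InnerProductSpace ℂ H] [CompleteSpace H] where
  /-- the representation -/
  π : A →⋆ₙₐ[ℂ] (H →L[ℂ] H)
  /-- the partial isometry -/
  U : H →L[ℂ] H
  faithful : Function.Injective π
  nondegenerate :
    (Submodule.span ℂ {x : H | ∃ (a : A) (h : H), π a h = x}).topologicalClosure = ⊤
  isPartialIsometry : IsPartialIsometry U

/-- `l` is a (contractive, two-sided) approximate unit of the ideal `I` of `A`.  Approximate units
are described by filters, as in Mathlib's `Filter.IsApproximateUnit`: a net `μ : Λ → I` corresponds
to its filter of tails `Filter.map μ atTop`. -/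
structure IsApproximateUnitOf {A : Type u} [CStarAlgebra A] (I : Set A) (l : Filter A) :
    Prop where
  neBot : l.NeBot
  eventually_mem : ∀ᶠ m in l, m ∈ I
  eventually_norm_le : ∀ᶠ m in l, ‖m‖ ≤ 1
  tendsto_mul_left : ∀ a ∈ I, Tendsto (fun m => a * m) l (𝓝 a)
  tendsto_mul_right : ∀ a ∈ I, Tendsto (fun m => m * a) l (𝓝 a)

namespace CovariantTriple

/-- `U π(a) = π(δ(a)) U` for all `a`. -/
def CR1 {A : Type u} [CStarAlgebra A] {H : Type v} [NormedAddCommGroup H]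
    [InnerProductSpace ℂ H] [CompleteSpace H] (T : CovariantTriple A H) (δ : A → A) : Prop :=
  ∀ a : A, T.U * T.π a = T.π (δ a) * T.U

/-- `π(δ(a)) = U π(a) U*` for all `a`. -/
def CR2 {A : Type u} [CStarAlgebra A] {H : Type v} [NormedAddCommGroup H]
    [InnerProductSpace ℂ H] [CompleteSpace H] (T : CovariantTriple A H) (δ : A → A) : Prop :=
  ∀ a : A, T.π (δ a) = T.U * T.π a * star T.U

/-- `U* U = 1 - s-lim π(μ)` where `μ` runs along an approximate unit of the kernel of `δ`: the
kernel has an approximate unit, and along each of them `π(μ)` converges strongly to `1 - U* U`. -/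
def StrictCR1 {A : Type u} [CStarAlgebra A] {H : Type v} [NormedAddCommGroup H]
    [InnerProductSpace ℂ H] [CompleteSpace H] (T : CovariantTriple A H) (δ : A → A) : Prop :=
  (∃ l : Filter A, IsApproximateUnitOf {a : A | δ a = 0} l) ∧
    ∀ l : Filter A, IsApproximateUnitOf {a : A | δ a = 0} l →
      ∀ h : H, Tendsto (fun m => T.π m h) l (𝓝 ((1 - star T.U * T.U) h))

/-- A covariant triple is a strict covariant representation of `(A, δ)`. -/
def IsStrict {A : Type u} [CStarAlgebra A] {H : Type v} [NormedAddCommGroup H]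
    [InnerProductSpace ℂ H] [CompleteSpace H] (T : CovariantTriple A H)
    (δ : A →⋆ₙₐ[ℂ] A) : Prop :=
  T.StrictCR1 δ ∧ T.CR2 δ

end CovariantTriple

end

/-! Strictness means that U*U is the projection onto the vectors killed by ker δ. On a GNS space
with cyclic vector ξ let Q be that projection. It commutes with the representation σ, so a ↦ ⟨Qξ,
σ(a)Qξ⟩ is positive, and it vanishes on ker δ. Hence it equals g ∘ δ on the range of δ, and the M.
Riesz extension theorem makes g positive on all of A (`PositiveLinearMap.exists_comp_eq`). Sending
σ(a)ξ to the class of δ(a) in the GNS space of g defines V with V*V = Q and Vσ(a) = σ_g(δ(a))V.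
Summing over all functionals and the iterates of f ↦ g gives one faithful representation with one
such V.

Here VV* may be smaller than σ(δ(1)). The defect c = σ(δ(1)) − VV* is a projection commuting with
σ(δ(a)). It is filled by adjoining coordinates that carry cσδ, cσδ², …, moved by a backward shift;
in coordinate 0 this gives Uπ(a)U* = σ(δ(a))(VV* + c) = σ(δ(a))
(`exists_covariant_rep_of_intertwiner`). Restricting to the range of π(1) gives nondegeneracy. The
strong limit holds because the vectors orthogonal to π(ker δ)H are exactly those killed by ker δ.

Conversely, (CR2) and faithfulness make δ linear and *-preserving, and (CR1) gives Uπ(a)π(b)U* =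
π(δ(a))Uπ(b)U*, which is multiplicativity. -/

section StrictCovariantRepresentations

open scoped ComplexOrder InnerProductSpace

/-! ### Positive functionals: separation, and factorization through δ -/

section PositiveFunctionals

variable {A : Type u} [CStarAlgebra A] [PartialOrder A] [StarOrderedRing A]

/-- A real functional that is nonnegative on the elements with nonnegative real part is the real
part of a positive complex functional. -/
theorem PositiveLinearMap.exists_eq_extendRCLike (G : A →ₗ[ℝ] ℝ)
    (hG : ∀ x : A, 0 ≤ x + star x → 0 ≤ G x) :
    ∃ g : A →ₚ[ℂ] ℂ, ∀ x, g x = (G x : ℂ) - Complex.I * (G (Complex.I • x) : ℂ) := by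
  refine ⟨PositiveLinearMap.mk₀ (Module.Dual.extendRCLike (𝕜 := ℂ) G) fun x hx => ?_, fun x => ?_⟩
  · have hs : star x = x := (IsSelfAdjoint.of_nonneg hx).star_eq
    -- For self-adjoint x both ix and −ix have zero real part, so G is nonnegative on both.
    have h0 : G (Complex.I • x) = 0 := by
      have h1 : 0 ≤ G (Complex.I • x) := hG _ (by simp [hs])
      have h2 : 0 ≤ G (-(Complex.I • x)) := hG _ (by simp [hs])
      rw [map_neg] at h2
      linarith
    have h1 : 0 ≤ G x := hG _ (by rw [hs]; exact add_nonneg hx hx)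
    rw [Module.Dual.extendRCLike_apply]
    simp [h0, h1]
  · exact Module.Dual.extendRCLike_apply G x

/-- Hahn–Banach: −b lies outside the closed cone of elements with nonnegative real part, and a
separating real functional is the real part of a positive one. -/
theorem PositiveLinearMap.exists_map_ne_zero {b : A} (hb : 0 ≤ b) (hb0 : b ≠ 0) :
    ∃ f : A →ₚ[ℂ] ℂ, f b ≠ 0 := by
  let C : ProperCone ℝ A :=
    { carrier := {x | 0 ≤ x + star x}
      add_mem' := fun {x y} hx hy => by
        have := add_nonneg (Set.mem_ofPred.1 hx) (Set.mem_ofPred.1 hy)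
        simp only [Set.mem_ofPred_eq, star_add]
        convert this using 1
        abel
      zero_mem' := by simp
      smul_mem' := fun c x hx => by
        have := smul_nonneg c.2 (Set.mem_ofPred.1 hx)
        simp only [Set.mem_ofPred_eq]
        convert this using 1
        rw [smul_add]
        congr 1
        exact star_smul (c : ℝ) x
      isClosed' := by
        exact CStarAlgebra.isClosed_nonneg.preimage (f := fun x : A => x + star x) (by fun_prop) }
  have hs : star b = b := (IsSelfAdjoint.of_nonneg hb).star_eq
  have hnot : -b ∉ C := fun h => by
    have h' : 0 ≤ -b + star (-b) := h
    rw [star_neg, hs] at h'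
    have h2 : b + b ≤ 0 := neg_nonneg.1 (by rwa [neg_add])
    exact hb0 (le_antisymm ((le_add_of_nonneg_left hb).trans h2) hb)
  obtain ⟨G, hG, hGb⟩ := C.hyperplane_separation_point hnot
  obtain ⟨g, hg⟩ := PositiveLinearMap.exists_eq_extendRCLike (G : A →ₗ[ℝ] ℝ) fun x hx => hG x hx
  refine ⟨g, fun h => ?_⟩
  have key : ∀ r t : ℝ, ((r : ℂ) - Complex.I * t).re = r := by simp
  have h0 : G b = 0 := by
    have := (key _ _).symm.trans (congrArg Complex.re ((hg b).symm.trans h))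
    exact this
  simp [h0] at hGb

/-- Replace a by its self-adjoint part and then by the positive part of that. Both operations
commute with δ and fix the positive element δ(a). -/
theorem NonUnitalStarAlgHom.exists_nonneg_of_map_nonneg (δ : A →⋆ₙₐ[ℂ] A) {a : A}
    (ha : 0 ≤ δ a) : ∃ b : A, 0 ≤ b ∧ δ b = δ a := by
  set s : A := (2⁻¹ : ℂ) • (a + star a) with hs
  have hsa : IsSelfAdjoint s := by
    rw [isSelfAdjoint_iff, hs]
    simp [add_comm]
  have hδs : δ s = δ a := by
    have h1 : star (δ a) = δ a := (IsSelfAdjoint.of_nonneg ha).star_eq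
    rw [hs, map_smul, map_add, map_star, h1, ← two_smul ℂ, smul_smul]
    simp
  refine ⟨s⁺, CFC.posPart_nonneg s, ?_⟩
  have hcont : Continuous δ := map_continuous δ
  rw [CFC.posPart_def, NonUnitalStarAlgHom.map_cfcₙ (S := ℂ) δ _ s (hφ := hcont) (hφa := hsa.map δ),
    hδs, ← CFC.posPart_def]
  exact CFC.posPart_eq_self (δ a) |>.2 ha

/-- A positive functional vanishing on the kernel of an endomorphism factors through it, with a
positive functional on the whole algebra as the second factor. -/
theorem PositiveLinearMap.exists_comp_eq (δ : A →⋆ₙₐ[ℂ] A) (F : A →ₚ[ℂ] ℂ)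
    (hF : ∀ a, δ a = 0 → F a = 0) : ∃ g : A →ₚ[ℂ] ℂ, ∀ a, g (δ a) = F a := by
  -- An algebraic extension only; it matters solely through its values on the range of δ.
  obtain ⟨h, hh⟩ : ∃ h : A →ₗ[ℝ] ℝ, ∀ a, h (δ a) = (F a).re := by
    let δ' : A →ₗ[ℝ] A :=
      { toFun := δ, map_add' := map_add δ
        map_smul' := fun r x => by
          have := map_smul δ (r : ℂ) x
          simpa using this }
    let F' : A →ₗ[ℝ] ℝ :=
      { toFun := fun a => (F a).re, map_add' := fun x y => by simp
        map_smul' := fun r x => by simp }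
    have hker : LinearMap.ker δ' ≤ LinearMap.ker F' := fun a ha => by
      have : δ a = 0 := ha
      simp [F', hF a this]
    obtain ⟨h, hh⟩ := LinearMap.exists_extend
      ((LinearMap.ker δ').liftQ F' hker ∘ₗ δ'.quotKerEquivRange.symm.toLinearMap)
    refine ⟨h, fun a => ?_⟩
    have h1 := LinearMap.congr_fun hh ⟨δ' a, ⟨a, rfl⟩⟩
    have h2 : δ'.quotKerEquivRange.symm ⟨δ' a, ⟨a, rfl⟩⟩ = Submodule.Quotient.mk a := by
      rw [LinearEquiv.symm_apply_eq]
      ext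
      simp
    simp only [LinearMap.comp_apply, LinearEquiv.coe_coe, h2] at h1
    exact h1
  set p : A := δ 1 with hp
  have hps : star p = p := by rw [hp, ← map_star, star_one]
  have hpl : ∀ a, p * δ a = δ a := fun a => by rw [hp, ← map_mul, one_mul]
  have hpr : ∀ a, δ a * p = δ a := fun a => by rw [hp, ← map_mul, mul_one]
  -- The range of δ need not contain 1, only p = δ(1). Compressing by p makes p play the role of an
  -- order unit, as the Riesz theorem requires.
  let s : PointedCone ℝ A :=
    { carrier := {x | 0 ≤ p * (x + star x) * p}
      add_mem' := fun {x y} hx hy => by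
        have := add_nonneg (Set.mem_ofPred.1 hx) (Set.mem_ofPred.1 hy)
        simp only [Set.mem_ofPred_eq, star_add]
        convert this using 1
        noncomm_ring
      zero_mem' := by simp
      smul_mem' := fun c x hx => by
        have := smul_nonneg c.2 (Set.mem_ofPred.1 hx)
        simp only [Set.mem_ofPred_eq]
        convert this using 1
        have h1 : star (c • x) = (c : ℝ) • star x := star_smul (c : ℝ) x
        rw [h1]
        change p * ((c : ℝ) • x + (c : ℝ) • star x) * p = _
        rw [← smul_add, mul_smul_comm, smul_mul_assoc] }
  have hmem : ∀ x : A, x ∈ s ↔ 0 ≤ p * (x + star x) * p := fun x => Iff.rfl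
  let D : Submodule ℝ A :=
    { carrier := Set.range δ
      add_mem' := by
        rintro _ _ ⟨x, rfl⟩ ⟨y, rfl⟩
        exact ⟨x + y, map_add δ x y⟩
      zero_mem' := ⟨0, map_zero δ⟩
      smul_mem' := by
        rintro c _ ⟨x, rfl⟩
        exact ⟨(c : ℂ) • x, by rw [map_smul]; simp⟩ }
  obtain ⟨G, hG, hGs⟩ := riesz_extension s ⟨D, h.domRestrict D⟩
    (by
      rintro ⟨_, a, rfl⟩ hx
      rw [hmem] at hx
      have hx' : 0 ≤ δ (a + star a) := by
        rw [mul_add, add_mul, ← map_star, hpl, hpl, hpr, hpr, ← map_add] at hx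
        exact hx
      obtain ⟨b, hb, hδ⟩ := δ.exists_nonneg_of_map_nonneg hx'
      have h1 : F (a + star a) = F b := by
        have := hF (a + star a - b) (by rw [map_sub, hδ, sub_self])
        rwa [map_sub, sub_eq_zero] at this
      have h2 : 0 ≤ (F (a + star a)).re := by
        rw [h1]
        exact (Complex.nonneg_iff.1 (F.map_nonneg hb)).1
      have h3 : (F (star a)).re = (F a).re := by
        rw [map_star]
        simp
      rw [map_add, Complex.add_re, h3] at h2
      change 0 ≤ h (δ a)
      rw [hh]
      linarith)
    (by
      intro y
      -- The vector δ(t·1) = tp contributes 2tp after symmetrization; one tp already dominates −p(y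
      -- + y*)p, the other is surplus.
      set t : ℝ := ‖y + star y‖ with ht
      refine ⟨⟨δ ((t : ℂ) • 1), _, rfl⟩, ?_⟩
      rw [hmem]
      have h1 : 0 ≤ algebraMap ℝ A t + (y + star y) := by
        have := (IsSelfAdjoint.add_star_self y).neg_algebraMap_norm_le_self
        rw [← ht] at this
        exact neg_le_iff_add_nonneg'.1 this
      have h2 : 0 ≤ algebraMap ℝ A t + (y + star y) + algebraMap ℝ A t :=
        add_nonneg h1 (algebraMap_nonneg A (norm_nonneg _))
      have h3 := star_left_conjugate_nonneg h2 p
      rw [hps] at h3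
      convert h3 using 1
      simp only [Algebra.algebraMap_eq_smul_one, map_smul, star_add, star_smul, ← hp, hps, mul_add,
        add_mul, mul_smul_comm, smul_mul_assoc, mul_one]
      have h4 : p * p = p := hpl 1
      simp [h4]
      abel)
  obtain ⟨g, hg⟩ := PositiveLinearMap.exists_eq_extendRCLike G fun x hx => hGs x <| by
    rw [hmem]
    have := star_left_conjugate_nonneg hx p
    rwa [hps] at this
  have hGδ : ∀ a, G (δ a) = (F a).re := fun a => by
    rw [← hh]
    exact hG ⟨δ a, a, rfl⟩
  refine ⟨g, fun a => ?_⟩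
  rw [hg, ← map_smul, hGδ, hGδ, map_smul]
  apply Complex.ext <;> simp

end PositiveFunctionals

/-! ### Approximate unit of the kernel -/

/-- The kernel of an endomorphism has a contractive approximate unit. -/
theorem NonUnitalStarAlgHom.exists_isApproximateUnitOf_ker {A : Type u} [CStarAlgebra A]
    (δ : A →⋆ₙₐ[ℂ] A) :
    ∃ l : Filter A, IsApproximateUnitOf {a : A | δ a = 0} l := by
  let I : NonUnitalStarSubalgebra ℂ A :=
    { carrier := {a | δ a = 0}
      add_mem' := fun {a b} (ha : δ a = 0) (hb : δ b = 0) => by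
        change δ (a + b) = 0
        rw [map_add, ha, hb, add_zero]
      zero_mem' := map_zero δ
      mul_mem' := fun {a b} (ha : δ a = 0) (hb : δ b = 0) => by
        change δ (a * b) = 0
        rw [map_mul, ha, zero_mul]
      smul_mem' := fun c a (ha : δ a = 0) => by
        change δ (c • a) = 0
        rw [map_smul, ha, smul_zero]
      star_mem' := fun {a} (ha : δ a = 0) => by
        change δ (star a) = 0
        rw [map_star, ha, star_zero] }
  have hclosed : IsClosed (I : Set A) := by
    have hcont : Continuous δ := AddMonoidHomClass.continuous_of_bound δ 1 fun b => by
      rw [one_mul]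
      exact NonUnitalStarAlgHom.norm_apply_le δ b
    exact isClosed_singleton.preimage hcont
  let : NonUnitalCStarAlgebra I :=
    NonUnitalStarSubalgebra.nonUnitalCStarAlgebra I (h_closed := hclosed)
  let : PartialOrder I := CStarAlgebra.spectralOrder I
  have : StarOrderedRing I := CStarAlgebra.spectralOrderedRing I
  have hl := CStarAlgebra.increasingApproximateUnit I
  have := hl.neBot
  refine ⟨(CStarAlgebra.approximateUnit I).map ((↑) : I → A), ⟨inferInstance, ?_, ?_, ?_, ?_⟩⟩
  · exact Filter.eventually_map.2 (Filter.Eventually.of_forall fun m => m.2)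
  · exact Filter.eventually_map.2 hl.eventually_norm
  · intro a ha
    exact Filter.tendsto_map'_iff.2
      ((continuous_subtype_val.tendsto _).comp (hl.tendsto_mul_left ⟨a, ha⟩))
  · intro a ha
    exact Filter.tendsto_map'_iff.2
      ((continuous_subtype_val.tendsto _).comp (hl.tendsto_mul_right ⟨a, ha⟩))

/-! ### Operators and representations on Hilbert sums -/

section HilbertSums

variable {J J' : Type*} {E : J → Type*} {F : J' → Type*}
  [∀ j, NormedAddCommGroup (E j)] [∀ j, InnerProductSpace ℂ (E j)]
  [∀ j, NormedAddCommGroup (F j)] [∀ j, InnerProductSpace ℂ (F j)]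

/-- The operator between Hilbert sums with components `y ↦ B j (y (φ j))`, where `φ` is an injective
map of the index sets and `B` a family of contractions up to the factor `C`. -/
noncomputable def lp.pullback (φ : J → J') (hφ : Function.Injective φ)
    (B : ∀ j, F (φ j) →L[ℂ] E j) (C : ℝ) (hB : ∀ j, ‖B j‖ ≤ C) : lp F 2 →L[ℂ] lp E 2 :=
  have hle : ∀ (y : lp F 2) (j : J), ‖B j (y (φ j))‖ ^ 2 ≤ C ^ 2 * ‖y (φ j)‖ ^ 2 := fun y j => by
    rw [← mul_pow]
    exact pow_le_pow_left₀ (norm_nonneg _) ((B j).le_of_opNorm_le (hB j) _) 2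
  have hs : ∀ y : lp F 2, Summable fun i => ‖y i‖ ^ 2 := fun y => by
    simpa using (lp.memℓp y).summable (by simp)
  have hsφ : ∀ y : lp F 2, Summable fun j => C ^ 2 * ‖y (φ j)‖ ^ 2 := fun y =>
    ((hs y).comp_injective hφ).mul_left _
  have hmem : ∀ y : lp F 2, Memℓp (fun j => B j (y (φ j))) 2 := fun y => by
    refine memℓp_gen ?_
    simpa using Summable.of_nonneg_of_le (fun j => by positivity) (hle y) (hsφ y)
  LinearMap.mkContinuous
    { toFun := fun y => ⟨fun j => B j (y (φ j)), hmem y⟩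
      map_add' := fun x y => by
        ext j
        exact map_add (B j) _ _
      map_smul' := fun c x => by
        ext j
        simp } |C| fun y => by
    refine lp.norm_le_of_tsum_le (p := 2) (by simp) (by positivity) ?_
    have hy : ‖y‖ ^ 2 = ∑' i, ‖y i‖ ^ 2 := by
      simpa using lp.norm_rpow_eq_tsum (p := 2) (by simp) y
    simp only [ENNReal.toReal_ofNat, Real.rpow_ofNat]
    rw [mul_pow, hy, sq_abs]
    calc ∑' j, ‖B j (y (φ j))‖ ^ 2 ≤ ∑' j, C ^ 2 * ‖y (φ j)‖ ^ 2 :=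
          (Summable.of_nonneg_of_le (fun j => by positivity) (hle y) (hsφ y)).tsum_le_tsum
            (hle y) (hsφ y)
      _ = C ^ 2 * ∑' j, ‖y (φ j)‖ ^ 2 := tsum_mul_left
      _ ≤ C ^ 2 * ∑' i, ‖y i‖ ^ 2 := by
          gcongr
          exact tsum_comp_le_tsum_of_inj (hs y) (fun i => by positivity) hφ

@[simp]
theorem lp.pullback_apply (φ : J → J') (hφ : Function.Injective φ)
    (B : ∀ j, F (φ j) →L[ℂ] E j) (C : ℝ) (hB : ∀ j, ‖B j‖ ≤ C) (y : lp F 2) (j : J) :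
    lp.pullback φ hφ B C hB y j = B j (y (φ j)) := rfl

variable [∀ j, CompleteSpace (E j)] [∀ j, CompleteSpace (F j)]

theorem lp.adjoint_pullback_apply (φ : J → J') (hφ : Function.Injective φ)
    (B : ∀ j, F (φ j) →L[ℂ] E j) (C : ℝ) (hB : ∀ j, ‖B j‖ ≤ C) (x : lp E 2) (j : J) :
    (lp.pullback φ hφ B C hB).adjoint x (φ j) = (B j).adjoint (x j) := by
  classical
  refine ext_inner_left ℂ fun z => ?_
  rw [← lp.inner_single_left, ContinuousLinearMap.adjoint_inner_right,
    ContinuousLinearMap.adjoint_inner_right, ← lp.inner_single_left]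
  congr 1
  ext i
  rw [lp.pullback_apply]
  by_cases h : i = j
  · subst h
    simp
  · rw [lp.single_apply_ne _ _ _ (hφ.ne h), lp.single_apply_ne _ _ _ h, map_zero]

theorem lp.adjoint_pullback_apply_of_notMem_range (φ : J → J') (hφ : Function.Injective φ)
    (B : ∀ j, F (φ j) →L[ℂ] E j) (C : ℝ) (hB : ∀ j, ‖B j‖ ≤ C) (x : lp E 2) {i : J'}
    (hi : i ∉ Set.range φ) : (lp.pullback φ hφ B C hB).adjoint x i = 0 := by
  classical
  refine ext_inner_left ℂ fun z => ?_
  rw [← lp.inner_single_left, ContinuousLinearMap.adjoint_inner_right, inner_zero_right]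
  convert inner_zero_left (𝕜 := ℂ) x
  ext j
  rw [lp.pullback_apply, lp.single_apply_ne _ _ _ (fun h => hi ⟨j, h⟩), map_zero]
  rfl

variable {A : Type*} [NonUnitalCStarAlgebra A]

/-- The Hilbert sum of a family of representations. -/
noncomputable def lp.directSumRep (ρ : ∀ j, A →⋆ₙₐ[ℂ] (E j →L[ℂ] E j)) :
    A →⋆ₙₐ[ℂ] (lp E 2 →L[ℂ] lp E 2) where
  toFun a := lp.pullback id Function.injective_id (fun j => ρ j a) ‖a‖
    fun j => NonUnitalStarAlgHom.norm_apply_le (ρ j) a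
  map_smul' c a := by
    ext x j
    simp
  map_zero' := by
    ext x j
    simp
  map_add' a b := by
    ext x j
    simp
  map_mul' a b := by
    ext x j
    simp
  map_star' a := by
    ext x j
    rw [ContinuousLinearMap.star_eq_adjoint]
    refine Eq.trans ?_ (lp.adjoint_pullback_apply id Function.injective_id (fun j => ρ j a) ‖a‖
      (fun j => NonUnitalStarAlgHom.norm_apply_le (ρ j) a) x j).symm
    change ρ j (star a) (x j) = _
    rw [map_star, ContinuousLinearMap.star_eq_adjoint]

@[simp]
theorem lp.directSumRep_apply (ρ : ∀ j, A →⋆ₙₐ[ℂ] (E j →L[ℂ] E j)) (a : A) (x : lp E 2) (j : J) :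
    lp.directSumRep ρ a x j = ρ j a (x j) := rfl

end HilbertSums

/-! ### Intertwiners between GNS representations -/

section Dilation

variable {A : Type u} [CStarAlgebra A]

section

variable {H : Type v} [NormedAddCommGroup H] [InnerProductSpace ℂ H] [CompleteSpace H]

/-- The vectors annihilated by the kernel of an endomorphism. -/
def kerAnnihilated (δ : A →⋆ₙₐ[ℂ] A) (σ : A →⋆ₙₐ[ℂ] (H →L[ℂ] H)) : Submodule ℂ H where
  carrier := {x | ∀ a, δ a = 0 → σ a x = 0}
  add_mem' := fun {x y} hx hy a ha => by rw [map_add, hx a ha, hy a ha, add_zero]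
  zero_mem' := fun a _ => map_zero _
  smul_mem' := fun c x hx a ha => by rw [map_smul, hx a ha, smul_zero]

theorem mem_kerAnnihilated {δ : A →⋆ₙₐ[ℂ] A} {σ : A →⋆ₙₐ[ℂ] (H →L[ℂ] H)} {x : H} :
    x ∈ kerAnnihilated δ σ ↔ ∀ a, δ a = 0 → σ a x = 0 := Iff.rfl

theorem isClosed_kerAnnihilated (δ : A →⋆ₙₐ[ℂ] A) (σ : A →⋆ₙₐ[ℂ] (H →L[ℂ] H)) :
    IsClosed (kerAnnihilated δ σ : Set H) := by
  have : (kerAnnihilated δ σ : Set H) = ⋂ a, ⋂ (_ : δ a = 0), {x | σ a x = 0} := by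
    ext x
    simp [mem_kerAnnihilated]
  rw [this]
  exact isClosed_iInter fun a => isClosed_iInter fun _ =>
    isClosed_singleton.preimage (σ a).continuous

instance (δ : A →⋆ₙₐ[ℂ] A) (σ : A →⋆ₙₐ[ℂ] (H →L[ℂ] H)) :
    (kerAnnihilated δ σ).HasOrthogonalProjection :=
  have := (isClosed_kerAnnihilated δ σ).completeSpace_coe
  inferInstance

theorem apply_mem_kerAnnihilated {δ : A →⋆ₙₐ[ℂ] A} {σ : A →⋆ₙₐ[ℂ] (H →L[ℂ] H)} {x : H}
    (hx : x ∈ kerAnnihilated δ σ) (a : A) : σ a x ∈ kerAnnihilated δ σ := fun c hc => by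
  have : σ (c * a) x = 0 := hx _ (by rw [map_mul, hc, zero_mul])
  rwa [map_mul] at this

theorem inner_rep_left (σ : A →⋆ₙₐ[ℂ] (H →L[ℂ] H)) (a : A) (x y : H) :
    ⟪σ a x, y⟫_ℂ = ⟪x, σ (star a) y⟫_ℂ := by
  rw [map_star, ContinuousLinearMap.star_eq_adjoint, ContinuousLinearMap.adjoint_inner_right]

/-- The kernel is an ideal, so the subspace is invariant under σ(A). As σ(A) is self-adjoint, the
subspace is reducing and its projection commutes with σ. -/
theorem starProjection_kerAnnihilated_apply (δ : A →⋆ₙₐ[ℂ] A) (σ : A →⋆ₙₐ[ℂ] (H →L[ℂ] H))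
    (a : A) (x : H) : (kerAnnihilated δ σ).starProjection (σ a x) =
      σ a ((kerAnnihilated δ σ).starProjection x) := by
  refine Submodule.eq_starProjection_of_mem_of_inner_eq_zero
    (apply_mem_kerAnnihilated (Submodule.starProjection_apply_mem _ _) a) fun w hw => ?_
  rw [← map_sub, inner_rep_left]
  exact Submodule.starProjection_inner_eq_zero _ _ (apply_mem_kerAnnihilated hw _)

end

/-- Each GNS representation is intertwined with `δ` and another GNS representation by an operator
whose initial space consists of the vectors annihilated by the kernel of `δ`. -/
theorem PositiveLinearMap.exists_intertwiner [PartialOrder A] [StarOrderedRing A]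
    (δ : A →⋆ₙₐ[ℂ] A) (f : A →ₚ[ℂ] ℂ) :
    ∃ (g : A →ₚ[ℂ] ℂ) (V : f.GNS →L[ℂ] g.GNS),
      (∀ a x, V (f.gnsNonUnitalStarAlgHom a x) = g.gnsNonUnitalStarAlgHom (δ a) (V x)) ∧
      (∀ x ∈ kerAnnihilated δ f.gnsNonUnitalStarAlgHom, V.adjoint (V x) = x) ∧ ‖V‖ ≤ 1 := by
  set σ := f.gnsNonUnitalStarAlgHom with hσ
  set M := kerAnnihilated δ σ
  set Q := M.starProjection
  let ξ : f.GNS := ((f.toPreGNS 1 : f.PreGNS) : UniformSpace.Completion f.PreGNS)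
  have hξ : ∀ a, σ a ξ = ((f.toPreGNS a : f.PreGNS) : UniformSpace.Completion f.PreGNS) :=
    fun a => by simp [ξ, hσ]
  have hinner : ∀ a b, ⟪Q ξ, σ (star a * b) (Q ξ)⟫_ℂ = ⟪Q (σ a ξ), Q (σ b ξ)⟫_ℂ := fun a b => by
    rw [starProjection_kerAnnihilated_apply, starProjection_kerAnnihilated_apply, inner_rep_left,
      map_mul]
    rfl
  let F : A →ₚ[ℂ] ℂ := PositiveLinearMap.mk₀
    { toFun := fun a => ⟪Q ξ, σ a (Q ξ)⟫_ℂ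
      map_add' := fun a b => by simp [inner_add_right]
      map_smul' := fun c a => by simp [inner_smul_right] } fun x hx => by
    obtain ⟨c, rfl⟩ := CStarAlgebra.nonneg_iff_eq_star_mul_self.1 hx
    change 0 ≤ ⟪Q ξ, σ (star c * c) (Q ξ)⟫_ℂ
    rw [hinner, inner_self_eq_norm_sq_to_K]
    rw [← RCLike.ofReal_pow]
    exact RCLike.ofReal_nonneg.2 (sq_nonneg _)
  have hF : ∀ a, F a = ⟪Q ξ, σ a (Q ξ)⟫_ℂ := fun a => rfl
  obtain ⟨g, hg⟩ := PositiveLinearMap.exists_comp_eq δ F fun a ha => by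
    rw [hF, Submodule.starProjection_apply_mem M ξ a ha, inner_zero_right]
  have hgQ : ∀ a b : A, g (star (δ a) * δ b) = ⟪Q (σ a ξ), Q (σ b ξ)⟫_ℂ := fun a b => by
    rw [← map_star, ← map_mul, hg, hF, hinner]
  -- By `hgQ`, the g-norm of δ(a) is ‖Qσ(a)ξ‖, at most the f-norm of a; hence the bound 1.
  let V₀ : f.PreGNS →L[ℂ] g.PreGNS := LinearMap.mkContinuous
    { toFun := fun a => g.toPreGNS (δ (f.ofPreGNS a))
      map_add' := fun a b => by simp
      map_smul' := fun c a => by simp } 1 fun a => by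
    have h1 : ‖Q (σ (f.ofPreGNS a) ξ)‖ ≤ ‖a‖ := by
      refine (M.norm_starProjection_apply_le _).trans ?_
      rw [hξ, UniformSpace.Completion.norm_coe]
      rfl
    rw [one_mul]
    refine le_trans (le_of_eq ?_) h1
    rw [← sq_eq_sq₀ (norm_nonneg _) (norm_nonneg _), ← Complex.ofReal_inj, Complex.ofReal_pow,
      PositiveLinearMap.preGNS_norm_sq, Complex.ofReal_pow]
    exact (hgQ _ _).trans (inner_self_eq_norm_sq_to_K _)
  let V : f.GNS →L[ℂ] g.GNS := V₀.completion
  have hV : ∀ a : f.PreGNS, V (a : f.GNS) = ((g.toPreGNS (δ (f.ofPreGNS a)) : g.PreGNS) :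
      UniformSpace.Completion g.PreGNS) := fun a => ContinuousLinearMap.completion_apply_coe V₀ a
  -- That is, V*V = Q; the isometry and norm claims both follow from it.
  have hVQ : ∀ x y, ⟪V x, V y⟫_ℂ = ⟪Q x, Q y⟫_ℂ := fun x y => by
    induction x, y using UniformSpace.Completion.induction_on₂ with
    | hp => exact isClosed_eq (by fun_prop) (by fun_prop)
    | ih a b =>
      rw [hV, hV, UniformSpace.Completion.inner_coe, PositiveLinearMap.preGNS_inner_def]
      exact (hgQ _ _).trans (by rw [hξ, hξ]; rfl)
  refine ⟨g, V, fun a x => ?_, fun x hx => ?_, ?_⟩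
  · induction x using UniformSpace.Completion.induction_on with
    | hp => exact isClosed_eq (by fun_prop) (by fun_prop)
    | ih b =>
      rw [hV]
      simp [hσ, hV]
  · refine ext_inner_right ℂ fun y => ?_
    rw [ContinuousLinearMap.adjoint_inner_left, hVQ, Submodule.starProjection_eq_self_iff.2 hx,
      ← Submodule.inner_starProjection_left_eq_right, Submodule.starProjection_eq_self_iff.2 hx]
  · refine ContinuousLinearMap.opNorm_le_bound _ zero_le_one fun x => ?_
    rw [one_mul]
    refine le_trans (le_of_eq ?_) (M.norm_starProjection_apply_le x)
    rw [← sq_eq_sq₀ (norm_nonneg _) (norm_nonneg _), ← Complex.ofReal_inj, Complex.ofReal_pow,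
      Complex.ofReal_pow]
    exact (inner_self_eq_norm_sq_to_K (𝕜 := ℂ) _).symm.trans
      ((hVQ x x).trans (inner_self_eq_norm_sq_to_K _))

end Dilation

/-! ### Summing the GNS intertwiners into one faithful representation -/

section Dilation

variable {A : Type u} [CStarAlgebra A]

/-- Intertwining operators between the members of a family of representations add up to an
intertwining operator of the Hilbert sum. -/
theorem lp.exists_directSumRep_intertwiner {J : Type*} {E : J → Type*}
    [∀ j, NormedAddCommGroup (E j)] [∀ j, InnerProductSpace ℂ (E j)] [∀ j, CompleteSpace (E j)]
    {δ : A →⋆ₙₐ[ℂ] A} (ρ : ∀ j, A →⋆ₙₐ[ℂ] (E j →L[ℂ] E j)) {φ : J → J}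
    (hφ : Function.Injective φ) (V : ∀ j, E j →L[ℂ] E (φ j))
    (hV : ∀ j a x, V j (ρ j a x) = ρ (φ j) (δ a) (V j x))
    (hVann : ∀ j, ∀ x ∈ kerAnnihilated δ (ρ j), (V j).adjoint (V j x) = x)
    (hVnorm : ∀ j, ‖V j‖ ≤ 1) :
    ∃ W : lp E 2 →L[ℂ] lp E 2,
      (∀ a x, W (lp.directSumRep ρ a x) = lp.directSumRep ρ (δ a) (W x)) ∧
      ∀ x ∈ kerAnnihilated δ (lp.directSumRep ρ), W.adjoint (W x) = x := by
  have hnorm : ∀ j, ‖(V j).adjoint‖ ≤ 1 := fun j => by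
    rw [LinearIsometryEquiv.norm_map]
    exact hVnorm j
  -- A pullback runs against φ, so it is built from the adjoints of the V j, and W is its adjoint.
  -- Coordinates of W x outside the range of φ vanish.
  let B : lp E 2 →L[ℂ] lp E 2 := lp.pullback φ hφ (fun j => (V j).adjoint) 1 hnorm
  have hB : ∀ x j, B.adjoint x (φ j) = V j (x j) := fun x j => by
    rw [lp.adjoint_pullback_apply, ContinuousLinearMap.adjoint_adjoint]
  refine ⟨B.adjoint, fun a x => ?_, fun x hx => ?_⟩
  · ext i
    rw [lp.directSumRep_apply]
    by_cases hi : i ∈ Set.range φ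
    · obtain ⟨j, rfl⟩ := hi
      rw [hB, hB, lp.directSumRep_apply, hV]
    · have h0 : ∀ y, B.adjoint y i = 0 := fun y =>
        lp.adjoint_pullback_apply_of_notMem_range φ hφ _ 1 hnorm y hi
      rw [h0, h0, map_zero]
  · ext j
    rw [ContinuousLinearMap.adjoint_adjoint, lp.pullback_apply, hB]
    refine hVann _ _ fun a ha => ?_
    rw [← lp.directSumRep_apply, hx a ha]
    rfl

/-- In the GNS space of f the image of the cyclic vector under a has squared norm f(a*a), and some
positive functional is nonzero at a*a. -/
theorem lp.injective_directSumRep_gns [PartialOrder A] [StarOrderedRing A] {J : Type*}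
    {s : J → (A →ₚ[ℂ] ℂ)} (hs : Function.Surjective s) :
    Function.Injective (lp.directSumRep fun j => (s j).gnsNonUnitalStarAlgHom) := by
  rw [injective_iff_map_eq_zero]
  intro a ha
  by_contra ha0
  obtain ⟨f, hf⟩ := PositiveLinearMap.exists_map_ne_zero (star_mul_self_nonneg a)
    (by rwa [ne_eq, CStarRing.star_mul_self_eq_zero_iff])
  apply hf
  obtain ⟨j, rfl⟩ := hs f
  classical
  let ξ : (s j).GNS :=
    (((s j).toPreGNS 1 : (s j).PreGNS) : UniformSpace.Completion (s j).PreGNS)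
  have h1 := lp.directSumRep_apply (fun j => (s j).gnsNonUnitalStarAlgHom) a (lp.single 2 j ξ) j
  rw [ha, lp.single_apply_self] at h1
  have h2 : (s j).gnsNonUnitalStarAlgHom a ξ = 0 := h1.symm
  have h3 : (((s j).toPreGNS a : (s j).PreGNS) : UniformSpace.Completion (s j).PreGNS) = 0 := by
    simpa [ξ] using h2
  have h4 : ‖(s j).toPreGNS a‖ = 0 := by
    rw [← UniformSpace.Completion.norm_coe]
    exact (congrArg norm h3).trans _root_.norm_zero
  have h5 := (s j).preGNS_norm_sq ((s j).toPreGNS a)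
  rw [h4] at h5
  simpa using h5.symm

theorem lp.directSumRep_gns_one [PartialOrder A] [StarOrderedRing A] {J : Type*}
    (s : J → (A →ₚ[ℂ] ℂ)) : lp.directSumRep (fun j => (s j).gnsNonUnitalStarAlgHom) 1 = 1 := by
  ext x j
  rw [lp.directSumRep_apply]
  exact congrFun (congrArg _ (map_one (s j).gnsStarAlgHom)) (x j)

/-- There is a faithful unital representation with an operator satisfying the intertwining relation
and acting isometrically on the vectors annihilated by the kernel of `δ`. -/
theorem exists_faithful_rep_intertwiner (δ : A →⋆ₙₐ[ℂ] A) :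
    ∃ (K : Type u) (_ : NormedAddCommGroup K) (_ : InnerProductSpace ℂ K) (_ : CompleteSpace K)
      (σ : A →⋆ₙₐ[ℂ] (K →L[ℂ] K)) (V : K →L[ℂ] K), Function.Injective σ ∧ σ 1 = 1 ∧
      (∀ a x, V (σ a x) = σ (δ a) (V x)) ∧
      ∀ x ∈ kerAnnihilated δ σ, V.adjoint (V x) = x := by
  let : PartialOrder A := CStarAlgebra.spectralOrder A
  have : StarOrderedRing A := CStarAlgebra.spectralOrderedRing A
  choose g V hV hVann hVnorm using PositiveLinearMap.exists_intertwiner δ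
  -- The assignment f ↦ g f need not be injective. Indexing its iterates by their length turns it
  -- into an injective shift of the index set.
  obtain ⟨t, ht0, ht⟩ : ∃ t : (A →ₚ[ℂ] ℂ) × ℕ → (A →ₚ[ℂ] ℂ), (∀ f, t (f, 0) = f) ∧
      ∀ f n, t (f, n + 1) = g (t (f, n)) :=
    ⟨fun j => Nat.rec j.1 (fun _ h => g h) j.2, fun _ => rfl, fun _ _ => rfl⟩
  let φ : (A →ₚ[ℂ] ℂ) × ℕ → (A →ₚ[ℂ] ℂ) × ℕ := fun j => (j.1, j.2 + 1)
  have hφ : Function.Injective φ := fun i j h => by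
    simp only [φ, Prod.mk.injEq, Nat.add_right_cancel_iff] at h
    exact Prod.ext h.1 h.2
  have hex : ∀ j, ∃ V : (t j).GNS →L[ℂ] (t (φ j)).GNS,
      (∀ a x, V ((t j).gnsNonUnitalStarAlgHom a x) =
        (t (φ j)).gnsNonUnitalStarAlgHom (δ a) (V x)) ∧
      (∀ x ∈ kerAnnihilated δ (t j).gnsNonUnitalStarAlgHom, V.adjoint (V x) = x) ∧ ‖V‖ ≤ 1 := by
    intro j
    rw [show t (φ j) = g (t j) from ht j.1 j.2]
    exact ⟨V (t j), hV _, hVann _, hVnorm _⟩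
  choose V hV hVann hVnorm using hex
  obtain ⟨W, hW, hWann⟩ := lp.exists_directSumRep_intertwiner (δ := δ)
    (E := fun j => (t j).GNS) (fun j => (t j).gnsNonUnitalStarAlgHom) hφ V hV hVann hVnorm
  exact ⟨_, inferInstance, inferInstance, inferInstance, _, W,
    lp.injective_directSumRep_gns fun f => ⟨(f, 0), ht0 f⟩, lp.directSumRep_gns_one t, hW, hWann⟩

/-! ### The initial projection of an intertwiner and the strong limit -/

section

variable {K : Type v} [NormedAddCommGroup K] [InnerProductSpace ℂ K] [CompleteSpace K]
  {δ : A →⋆ₙₐ[ℂ] A} {σ : A →⋆ₙₐ[ℂ] (K →L[ℂ] K)} {V : K →L[ℂ] K}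

theorem adjoint_apply_rep (hV : ∀ a x, V (σ a x) = σ (δ a) (V x)) (a : A) (x : K) :
    V.adjoint (σ (δ a) x) = σ a (V.adjoint x) := by
  refine ext_inner_left ℂ fun y => ?_
  have h := inner_rep_left σ (star a) y (V.adjoint x)
  have h' := inner_rep_left σ (star (δ a)) (V y) x
  rw [star_star] at h h'
  rw [ContinuousLinearMap.adjoint_inner_right, ← h, ← h', ContinuousLinearMap.adjoint_inner_right,
    hV, map_star δ]

/-- From σ(a)V* = V*σ(δ(a)), the kernel kills the whole range of V*. If V*V also fixes the vectors
killed by ker δ, it is the projection onto them. -/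
theorem adjoint_apply_self_mem_kerAnnihilated (hV : ∀ a x, V (σ a x) = σ (δ a) (V x)) (x : K) :
    V.adjoint (V x) ∈ kerAnnihilated δ σ := fun a ha => by
  rw [← adjoint_apply_rep hV, ha, map_zero]
  simp

/-- An operator as in `exists_faithful_rep_intertwiner` is a partial isometry. -/
theorem apply_adjoint_apply_self (hV : ∀ a x, V (σ a x) = σ (δ a) (V x))
    (hVann : ∀ x ∈ kerAnnihilated δ σ, V.adjoint (V x) = x) (x : K) :
    V (V.adjoint (V x)) = V x := by
  have h := hVann _ (adjoint_apply_self_mem_kerAnnihilated hV x)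
  rw [← sub_eq_zero, ← map_sub, ← inner_self_eq_zero (𝕜 := ℂ),
    ← ContinuousLinearMap.adjoint_inner_right, map_sub, map_sub, h, sub_self, inner_zero_right]

/-- A strict covariant representation satisfies the strong limit condition. -/
theorem tendsto_rep_approximateUnit (hV : ∀ a x, V (σ a x) = σ (δ a) (V x))
    (hVann : ∀ x ∈ kerAnnihilated δ σ, V.adjoint (V x) = x)
    {l : Filter A} (hl : IsApproximateUnitOf {a : A | δ a = 0} l) (x : K) :
    Tendsto (fun m => σ m x) l (𝓝 (x - V.adjoint (V x))) := by
  set N : Submodule ℂ K := Submodule.span ℂ {y | ∃ a, δ a = 0 ∧ ∃ z, σ a z = y} with hN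
  have hNperp : ∀ y ∈ Nᗮ, y ∈ kerAnnihilated δ σ := fun y hy a ha => by
    refine ext_inner_left ℂ fun z => ?_
    have h := inner_rep_left σ (star a) z y
    rw [star_star] at h
    rw [← h, inner_zero_right]
    exact Submodule.mem_orthogonal _ _ |>.1 hy _
      (Submodule.subset_span ⟨star a, by rw [map_star, ha, star_zero], z, rfl⟩)
  set r := x - V.adjoint (V x) with hr
  -- By the double orthogonal complement: vectors orthogonal to N are killed by ker δ, hence fixed
  -- by V*V and orthogonal to x − V*Vx.
  have hrN : r ∈ N.topologicalClosure := by
    rw [← Submodule.orthogonal_orthogonal_eq_closure, Submodule.mem_orthogonal]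
    intro y hy
    rw [hr, inner_sub_right, ContinuousLinearMap.adjoint_inner_right,
      ← ContinuousLinearMap.adjoint_inner_left, hVann y (hNperp y hy), sub_self]
  have hcongr : (fun m => σ m r) =ᶠ[l] fun m => σ m x := by
    filter_upwards [hl.eventually_mem] with m hm
    rw [hr, map_sub, adjoint_apply_self_mem_kerAnnihilated hV x m hm, sub_zero]
  refine Tendsto.congr' hcongr ?_
  have hspan : ∀ y ∈ N, Tendsto (fun m => σ m y) l (𝓝 y) := fun y hy => by
    induction hy using Submodule.span_induction with
    | mem y h =>
      obtain ⟨a, ha, z, rfl⟩ := h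
      have h1 : Tendsto (fun m => σ (m * a)) l (𝓝 (σ a)) :=
        ((AddMonoidHomClass.continuous_of_bound σ 1 fun b => by
          rw [one_mul]
          exact NonUnitalStarAlgHom.norm_apply_le σ b).tendsto a).comp (hl.tendsto_mul_right a ha)
      have h2 := ((ContinuousLinearMap.apply ℂ K z).continuous.tendsto _).comp h1
      refine h2.congr fun m => ?_
      simp
    | zero => simpa using tendsto_const_nhds
    | add y z _ _ hy hz => simpa using hy.add hz
    | smul c y _ hy => simpa using hy.const_smul c
  rw [Metric.tendsto_nhds]
  intro ε hε
  obtain ⟨y, hy, hyr⟩ := Metric.mem_closure_iff.1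
    (show r ∈ closure (N : Set K) from hrN) (ε / 3) (by positivity)
  filter_upwards [Metric.tendsto_nhds.1 (hspan y hy) (ε / 3) (by positivity),
    hl.eventually_norm_le] with m hm hm1
  have h1 : dist (σ m r) (σ m y) ≤ dist r y := by
    rw [dist_eq_norm, dist_eq_norm, ← map_sub]
    refine ((σ m).le_of_opNorm_le ((NonUnitalStarAlgHom.norm_apply_le σ m).trans hm1) _).trans ?_
    rw [one_mul]
  calc dist (σ m r) r ≤ dist (σ m r) (σ m y) + dist (σ m y) y + dist y r :=
        dist_triangle4 _ _ _ _
    _ < ε := by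
        rw [dist_comm y r]
        linarith

end

end Dilation

/-! ### Filling the defect of the range projection, then passing to the essential subspace -/

section Dilation

variable {A : Type u} [CStarAlgebra A]

section

variable {K : Type v} [NormedAddCommGroup K] [InnerProductSpace ℂ K] [CompleteSpace K]
  {δ : A →⋆ₙₐ[ℂ] A} {σ : A →⋆ₙₐ[ℂ] (K →L[ℂ] K)} {V : K →L[ℂ] K}

/-- The projection complementing the range projection of an intertwining operator. -/
theorem exists_complementary_projection (hone : σ 1 = 1)
    (hV : ∀ a x, V (σ a x) = σ (δ a) (V x))
    (hVann : ∀ x ∈ kerAnnihilated δ σ, V.adjoint (V x) = x) :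
    ∃ c : K →L[ℂ] K, star c = c ∧ c * c = c ∧ c * V = 0 ∧
      (∀ a, c * σ (δ a) = σ (δ a) * c) ∧ V * star V + c = σ (δ 1) := by
  have hVσ : ∀ a, V * σ a = σ (δ a) * V := fun a => by
    ext x
    exact hV a x
  have hσV : ∀ a, star V * σ (δ a) = σ a * star V := fun a => by
    ext x
    exact adjoint_apply_rep hV a x
  have hVVV : V * (star V * V) = V := by
    ext x
    exact apply_adjoint_apply_self hV hVann x
  have hpV : σ (δ 1) * V = V := by rw [← hVσ, hone, mul_one]
  have hVp : star V * σ (δ 1) = star V := by rw [hσV, hone, one_mul]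
  have hcV : (σ (δ 1) - V * star V) * V = 0 := by rw [sub_mul, hpV, mul_assoc, hVVV, sub_self]
  have hcp : (σ (δ 1) - V * star V) * σ (δ 1) = σ (δ 1) - V * star V := by
    rw [sub_mul, ← map_mul, ← map_mul, one_mul, mul_assoc, hVp]
  refine ⟨σ (δ 1) - V * star V, ?_, ?_, hcV, fun a => ?_, add_sub_cancel _ _⟩
  · rw [star_sub, ← map_star, ← map_star, star_one, star_mul, star_star]
  · rw [mul_sub, hcp, ← mul_assoc, hcV, zero_mul, sub_zero]
  · rw [sub_mul, mul_sub, ← map_mul, ← map_mul, ← map_mul, ← map_mul, one_mul, mul_one,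
      mul_assoc, hσV, ← mul_assoc, hVσ, mul_assoc]

/-- Cutting down `σ ∘ δ ^ (n + 1)` by a projection commuting with the range of `σ ∘ δ`. -/
theorem exists_cutdown_reps {c : K →L[ℂ] K} (hcstar : star c = c) (hcc : c * c = c)
    (hcσ : ∀ a, c * σ (δ a) = σ (δ a) * c) :
    ∃ ρ : ℕ → (A →⋆ₙₐ[ℂ] (K →L[ℂ] K)), ρ 0 = σ ∧ (∀ a, ρ 1 a = c * σ (δ a)) ∧
      (∀ n a, ρ (n + 2) a = ρ (n + 1) (δ a)) ∧ (∀ n a, c * ρ (n + 1) a = ρ (n + 1) a) ∧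
      ∀ n a, ρ (n + 1) a * c = ρ (n + 1) a := by
  let τ : A →⋆ₙₐ[ℂ] (K →L[ℂ] K) :=
    { toFun := fun a => c * σ (δ a)
      map_smul' := fun r a => by
        rw [map_smul, map_smul, mul_smul_comm]
        rfl
      map_zero' := by rw [map_zero, map_zero, mul_zero]
      map_add' := fun a b => by rw [map_add, map_add, mul_add]
      map_mul' := fun a b => by
        rw [map_mul, map_mul, mul_assoc c, ← mul_assoc (σ (δ a)) c, ← hcσ, mul_assoc c,
          ← mul_assoc c c, hcc]
      map_star' := fun a => by
        rw [map_star, map_star, star_mul, hcstar, ← map_star, ← map_star, hcσ] }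
  have hτ : ∀ a, τ a = c * σ (δ a) := fun a => rfl
  obtain ⟨θ, hθ0, hθ⟩ : ∃ θ : ℕ → (A →⋆ₙₐ[ℂ] (K →L[ℂ] K)), θ 0 = τ ∧
      ∀ n a, θ (n + 1) a = θ n (δ a) :=
    ⟨fun n => Nat.rec τ (fun _ r => r.comp δ) n, rfl, fun _ _ => rfl⟩
  have hcθ : ∀ n a, c * θ n a = θ n a := fun n => by
    induction n with
    | zero =>
      intro a
      rw [hθ0, hτ, ← mul_assoc, hcc]
    | succ n ih =>
      intro a
      rw [hθ, ih]
  have hθc : ∀ n a, θ n a * c = θ n a := fun n a => by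
    have := congrArg star (hcθ n (star a))
    rwa [star_mul, hcstar, ← map_star, star_star] at this
  -- Coordinate 0 carries σ, and coordinate n + 1 carries θ n, which is cσδ^(n+1).
  exact ⟨fun n => Nat.casesOn n σ θ, rfl, fun a => congrFun (congrArg _ hθ0) a, hθ, hcθ, hθc⟩

theorem exists_diagonal (v : ℕ → (K →L[ℂ] K)) (C : ℝ) (hv : ∀ n, ‖v n‖ ≤ C) :
    ∃ D : lp (fun _ : ℕ => K) 2 →L[ℂ] lp (fun _ : ℕ => K) 2,
      (∀ x n, D x n = v n (x n)) ∧ ∀ x n, star D x n = star (v n) (x n) :=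
  ⟨lp.pullback (E := fun _ : ℕ => K) (F := fun _ : ℕ => K) id Function.injective_id v C hv,
    fun _ _ => rfl, fun x n => lp.adjoint_pullback_apply (E := fun _ : ℕ => K)
      (F := fun _ : ℕ => K) id Function.injective_id v C hv x n⟩

theorem exists_backward_shift (c : K →L[ℂ] K) :
    ∃ S : lp (fun _ : ℕ => K) 2 →L[ℂ] lp (fun _ : ℕ => K) 2,
      (∀ x n, S x n = c (x (n + 1))) ∧ (∀ x, star S x 0 = 0) ∧
        ∀ x n, star S x (n + 1) = star c (x n) := by
  refine ⟨lp.pullback (E := fun _ : ℕ => K) (F := fun _ : ℕ => K) Nat.succ Nat.succ_injective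
    (fun _ => c) ‖c‖ fun _ => le_rfl, fun _ _ => rfl, fun x => ?_, fun x n => ?_⟩
  · exact lp.adjoint_pullback_apply_of_notMem_range (E := fun _ : ℕ => K) (F := fun _ : ℕ => K) _
      Nat.succ_injective _ _ _ x (by simp)
  · exact lp.adjoint_pullback_apply (E := fun _ : ℕ => K) (F := fun _ : ℕ => K) Nat.succ
      Nat.succ_injective (fun _ => c) ‖c‖ (fun _ => le_rfl) x n

/-- U is the sum of V acting in coordinate 0 alone and the backward shift weighted by c. -/
theorem exists_weighted_shift (V : K →L[ℂ] K) {c : K →L[ℂ] K} (hcstar : star c = c) :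
    ∃ U : lp (fun _ : ℕ => K) 2 →L[ℂ] lp (fun _ : ℕ => K) 2,
      (∀ x, U x 0 = V (x 0) + c (x 1)) ∧ (∀ x n, U x (n + 1) = c (x (n + 2))) ∧
      (∀ x, star U x 0 = star V (x 0)) ∧ ∀ x n, star U x (n + 1) = c (x n) := by
  obtain ⟨v, hv0, hv⟩ : ∃ v : ℕ → (K →L[ℂ] K), v 0 = V ∧ ∀ n, v (n + 1) = 0 :=
    ⟨fun n => Nat.casesOn n V fun _ => 0, rfl, fun _ => rfl⟩
  have hvnorm : ∀ n, ‖v n‖ ≤ ‖V‖ := fun n => by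
    cases n with
    | zero => rw [hv0]
    | succ n => rw [hv, norm_zero]; exact norm_nonneg _
  obtain ⟨D, hD, hD'⟩ := exists_diagonal v ‖V‖ hvnorm
  obtain ⟨S, hS, hS0, hS'⟩ := exists_backward_shift c
  have hadd : ∀ (T₁ T₂ : lp (fun _ : ℕ => K) 2 →L[ℂ] lp (fun _ : ℕ => K) 2) x n,
      (T₁ + T₂) x n = T₁ x n + T₂ x n := fun _ _ _ _ => rfl
  refine ⟨D + S, fun x => ?_, fun x n => ?_, fun x => ?_, fun x n => ?_⟩
  · rw [hadd, hD, hS, hv0]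
  · rw [hadd, hD, hS, hv]
    exact zero_add _
  · rw [star_add, hadd, hD', hS0, hv0, add_zero]
  · rw [star_add, hadd, hD', hS', hv, hcstar, star_zero]
    exact zero_add _

/-- Enlarging the space of an intertwining operator turns it into an operator that implements the
endomorphism by conjugation. -/
theorem exists_covariant_rep_of_intertwiner (hinj : Function.Injective σ) (hone : σ 1 = 1)
    (hV : ∀ a x, V (σ a x) = σ (δ a) (V x))
    (hVann : ∀ x ∈ kerAnnihilated δ σ, V.adjoint (V x) = x) :
    ∃ (H : Type v) (_ : NormedAddCommGroup H) (_ : InnerProductSpace ℂ H) (_ : CompleteSpace H)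
      (π : A →⋆ₙₐ[ℂ] (H →L[ℂ] H)) (U : H →L[ℂ] H), Function.Injective π ∧
      (∀ a, U * π a = π (δ a) * U) ∧ (∀ a, π (δ a) = U * π a * star U) ∧
      ∀ x ∈ kerAnnihilated δ π, π 1 x = x → star U (U x) = x := by
  obtain ⟨c, hcstar, hcc, hcV, hcσ, hVc⟩ := exists_complementary_projection hone hV hVann
  obtain ⟨ρ, hρ0, hρ1, hρ, hcρ, hρc⟩ := exists_cutdown_reps hcstar hcc hcσ
  obtain ⟨U, hU0, hU, hUs0, hUs⟩ := exists_weighted_shift V hcstar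
  have hVc0 : star V * c = 0 := by
    rw [← hcstar, ← star_mul, hcV, star_zero]
  have app : ∀ {S T : K →L[ℂ] K}, S = T → ∀ x, S x = T x := fun h x => by rw [h]
  refine ⟨lp (fun _ : ℕ => K) 2, inferInstance, inferInstance, inferInstance,
    lp.directSumRep ρ, U, ?_, fun a => ?_, fun a => ?_, fun x hx hx1 => ?_⟩
  · rw [injective_iff_map_eq_zero]
    intro a ha
    apply (injective_iff_map_eq_zero σ).1 hinj
    ext x
    have h := lp.directSumRep_apply ρ a (lp.single 2 0 x) 0
    rw [ha, lp.single_apply_self, hρ0] at h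
    exact h.symm
  · ext x n
    change U (lp.directSumRep ρ a x) n = lp.directSumRep ρ (δ a) (U x) n
    cases n with
    | zero =>
      rw [hU0, lp.directSumRep_apply, lp.directSumRep_apply, lp.directSumRep_apply, hU0, hρ0,
        map_add, hV]
      congr 1
      refine app (S := c * ρ 1 a) (T := σ (δ a) * c) ?_ (x 1)
      rw [hρ1, ← mul_assoc, hcc, hcσ]
    | succ n =>
      rw [hU, lp.directSumRep_apply, lp.directSumRep_apply, hU]
      refine app (S := c * ρ (n + 2) a) (T := ρ (n + 1) (δ a) * c) ?_ (x (n + 2))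
      rw [hcρ, hρc, hρ]
  · ext x n
    change lp.directSumRep ρ (δ a) x n = U (lp.directSumRep ρ a (star U x)) n
    cases n with
    | zero =>
      rw [hU0, lp.directSumRep_apply, lp.directSumRep_apply, lp.directSumRep_apply, hUs0, hUs, hρ0]
      refine app (S := σ (δ a)) (T := σ (δ a) * (V * star V) + c * ρ 1 a * c) ?_ (x 0) |>.trans ?_
      · rw [hcρ, hρ1, hcσ, mul_assoc, hcc, ← mul_add, hVc, ← map_mul, ← map_mul, mul_one]
      · rw [hV]
        rfl
    | succ n =>
      rw [hU, lp.directSumRep_apply, lp.directSumRep_apply, hUs]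
      refine app (S := ρ (n + 1) (δ a)) (T := c * ρ (n + 2) a * c) ?_ (x (n + 1))
      rw [hcρ, hρc, hρ]
  -- Being fixed by π(1) puts the later coordinates in the range of c, where the shift is isometric.
  -- Being killed by ker δ is needed only in coordinate 0, and the cross terms V*c and cV are zero.
  · have hxn : ∀ n, c (x (n + 1)) = x (n + 1) := fun n => by
      have h := lp.directSumRep_apply ρ 1 x (n + 1)
      rw [hx1] at h
      rw [h]
      exact app (hcρ n 1) _
    have hx0 : x 0 ∈ kerAnnihilated δ σ := fun a ha => by
      have h := lp.directSumRep_apply ρ a x 0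
      rw [hx a ha, hρ0] at h
      exact h.symm
    ext n
    match n with
    | 0 =>
      rw [hUs0, hU0, map_add]
      exact (congrArg₂ (· + ·) (hVann _ hx0) (app hVc0 (x 1))).trans (add_zero _)
    | 1 =>
      rw [hUs, hU0, map_add, hxn, hxn]
      exact (congrArg (· + x 1) (app hcV (x 0))).trans (zero_add _)
    | n + 2 => rw [hUs, hU, hxn, hxn]

end

/-- The endomorphism of a covariant pair on `H` is implemented by a covariant triple on the
essential subspace of the representation. -/
theorem exists_isStrict_of_covariant_rep {H : Type v} [NormedAddCommGroup H]
    [InnerProductSpace ℂ H] [CompleteSpace H] {δ : A →⋆ₙₐ[ℂ] A}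
    {π : A →⋆ₙₐ[ℂ] (H →L[ℂ] H)} {U : H →L[ℂ] H} (hinj : Function.Injective π)
    (hCR1 : ∀ a, U * π a = π (δ a) * U) (hCR2 : ∀ a, π (δ a) = U * π a * star U)
    (hann : ∀ x ∈ kerAnnihilated δ π, π 1 x = x → star U (U x) = x) :
    ∃ (M : Type v) (_ : NormedAddCommGroup M) (_ : InnerProductSpace ℂ M) (_ : CompleteSpace M)
      (T : CovariantTriple A M), T.IsStrict δ ∧ T.CR1 δ := by
  set p := π 1 with hp
  have hpl : ∀ a, p * π a = π a := fun a => by rw [hp, ← map_mul, one_mul]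
  have hpr : ∀ a, π a * p = π a := fun a => by rw [hp, ← map_mul, mul_one]
  let M : Submodule ℂ H := LinearMap.ker ((1 - p : H →L[ℂ] H) : H →ₗ[ℂ] H)
  have hM : ∀ x, x ∈ M ↔ p x = x := fun x => by
    change x - p x = 0 ↔ _
    rw [sub_eq_zero, eq_comm]
  have hMc : IsClosed (M : Set H) := (1 - p : H →L[ℂ] H).isClosed_ker
  have : CompleteSpace M := hMc.completeSpace_coe
  let ι : M →L[ℂ] H := M.subtypeL
  have hpapp : ∀ x, p (p x) = p x := fun x => congrFun (congrArg DFunLike.coe (hpl 1)) x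
  have hproj : ∀ x, ι (ι.adjoint x) = p x := fun x => by
    rw [Submodule.adjoint_subtypeL]
    change M.starProjection x = p x
    refine (Submodule.eq_starProjection_of_mem_of_inner_eq_zero ((hM _).2 (hpapp x))
      fun w hw => ?_)
    have h := inner_rep_left π 1 (x - p x) w
    rw [star_one, ← hp, (hM w).1 hw, map_sub, hpapp, sub_self, inner_zero_left] at h
    exact h.symm
  have hι : ∀ x, ι.adjoint (ι x) = x := fun x => by
    apply Subtype.val_injective
    exact (hproj _).trans ((hM _).1 x.2)
  let κ : (H →L[ℂ] H) → (M →L[ℂ] M) := fun T => ι.adjoint ∘L T ∘L ι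
  have hκ : ∀ T x, κ T x = ι.adjoint (T (ι x)) := fun T x => rfl
  -- Compression to M inserts p between factors. Each π(a) absorbs p, and U maps the range of p into
  -- itself (`hpU`), so the relations survive.
  have hκmul : ∀ S T, κ S * κ T = κ (S * p * T) := fun S T => by
    ext1 x
    change ι.adjoint (S (ι (ι.adjoint (T (ι x))))) = ι.adjoint (S (p (T (ι x))))
    rw [hproj]
  have hκstar : ∀ T, star (κ T) = κ (star T) := fun T => by
    simp only [κ, ContinuousLinearMap.star_eq_adjoint, ContinuousLinearMap.adjoint_comp,
      ContinuousLinearMap.adjoint_adjoint]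
    rfl
  let π' : A →⋆ₙₐ[ℂ] (M →L[ℂ] M) :=
    { toFun := fun a => κ (π a)
      map_smul' := fun r a => by
        ext1 x
        simp [hκ]
      map_zero' := by
        ext1 x
        simp [hκ]
      map_add' := fun a b => by
        ext1 x
        simp [hκ]
      map_mul' := fun a b => by rw [hκmul, hpr, map_mul]
      map_star' := fun a => by rw [hκstar, map_star] }
  have hπ' : ∀ a, π' a = κ (π a) := fun a => rfl
  have hpU : p * (U * p) = U * p := by
    rw [hp, hCR1, ← mul_assoc, ← hp, hpl]
  have hCR1' : ∀ a, κ U * π' a = π' (δ a) * κ U := fun a => by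
    rw [hπ', hπ', hκmul, hκmul, mul_assoc, hpl, hpr, hCR1]
  have hUU : ∀ x, star (κ U) (κ U x) = ι.adjoint (star U (U (ι x))) := fun x => by
    have h1 : p (U (ι x)) = U (ι x) := by
      have := congrFun (congrArg DFunLike.coe hpU) (ι x)
      have hx : p (ι x) = ι x := (hM _).1 x.2
      change p (U (p (ι x))) = U (p (ι x)) at this
      rwa [hx] at this
    rw [hκstar, hκ, hκ, hproj, h1]
  have hCR1x : ∀ a x, κ U (π' a x) = π' (δ a) (κ U x) := fun a x =>
    congrFun (congrArg DFunLike.coe (hCR1' a)) x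
  have hann' : ∀ x ∈ kerAnnihilated δ π', (κ U).adjoint (κ U x) = x := fun x hx => by
    refine (hUU x).trans ?_
    rw [hann (ι x) (fun a ha => ?_) ((hM _).1 x.2), hι]
    have h : ι (ι.adjoint (π a (ι x))) = 0 := by
      have := congrArg ι (hx a ha)
      rwa [map_zero] at this
    rw [hproj] at h
    exact (congrFun (congrArg DFunLike.coe (hpl a)) (ι x)).symm.trans h
  have hone : π' 1 = 1 := by
    ext1 x
    rw [hπ', hκ, ← hp, show p (ι x) = ι x from (hM _).1 x.2]
    exact hι x
  let T : CovariantTriple A M :=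
    { π := π'
      U := κ U
      faithful := by
        rw [injective_iff_map_eq_zero]
        intro a ha
        apply (injective_iff_map_eq_zero π).1 hinj
        rw [← hpl, ← hpr]
        ext x
        change p (π a (p x)) = 0
        rw [← hproj, ← hproj]
        have : ι.adjoint (π a (ι (ι.adjoint x))) = 0 :=
          congrFun (congrArg DFunLike.coe ha) (ι.adjoint x)
        rw [this, map_zero]
      nondegenerate := by
        rw [eq_top_iff]
        intro x _
        refine Submodule.le_topologicalClosure _ (Submodule.subset_span ⟨1, x, ?_⟩)
        rw [hone]
        rfl
      isPartialIsometry := by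
        ext1 x
        exact apply_adjoint_apply_self hCR1x hann' x }
  refine ⟨M, inferInstance, inferInstance, this, T, ⟨⟨δ.exists_isApproximateUnitOf_ker,
    fun l hl x => tendsto_rep_approximateUnit hCR1x hann' hl x⟩, fun a => ?_⟩, hCR1'⟩
  change κ (π (δ a)) = κ U * κ (π a) * star (κ U)
  rw [hκstar, hκmul, hκmul, mul_assoc U, hpl, mul_assoc U, hpr, hCR2]

/-- Every endomorphism has a strict covariant representation. -/
theorem exists_isStrict (δ : A →⋆ₙₐ[ℂ] A) :
    ∃ (H : Type u) (_ : NormedAddCommGroup H) (_ : InnerProductSpace ℂ H)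
      (_ : CompleteSpace H) (T : CovariantTriple A H), T.IsStrict δ ∧ T.CR1 δ := by
  obtain ⟨K, _, _, _, σ, V, hinj, hone, hV, hVann⟩ := exists_faithful_rep_intertwiner δ
  obtain ⟨H, _, _, _, π, U, hπ, hCR1, hCR2, hann⟩ :=
    exists_covariant_rep_of_intertwiner hinj hone hV hVann
  exact exists_isStrict_of_covariant_rep hπ hCR1 hCR2 hann

/-- A map implemented by a covariant triple is an endomorphism. -/
theorem CovariantTriple.exists_starAlgHom {H : Type v} [NormedAddCommGroup H]
    [InnerProductSpace ℂ H] [CompleteSpace H] (T : CovariantTriple A H) {δ : A → A}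
    (h1 : T.CR1 δ) (h2 : T.CR2 δ) : ∃ φ : A →⋆ₙₐ[ℂ] A, ∀ a, φ a = δ a :=
  ⟨{ toFun := δ
     map_smul' := fun c a => T.faithful <| by
      rw [h2, map_smul, MonoidHom.id_apply, map_smul, h2, mul_smul_comm, smul_mul_assoc]
     map_zero' := T.faithful <| by rw [h2, map_zero, mul_zero, zero_mul]
     map_add' := fun a b => T.faithful <| by
      rw [h2, map_add, map_add, h2, h2, mul_add, add_mul]
     map_mul' := fun a b => T.faithful <| by
      rw [h2, map_mul, map_mul, ← mul_assoc, h1, mul_assoc, mul_assoc, ← mul_assoc T.U, ← h2]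
     map_star' := fun a => T.faithful <| by
      rw [h2, map_star, map_star, h2, star_mul, star_mul, star_star, mul_assoc] }, fun _ => rfl⟩

end Dilation

end StrictCovariantRepresentations

theorem mainTheorem3 (A : Type u) [CStarAlgebra A] :
    (∀ δ : A →⋆ₙₐ[ℂ] A,
      ∃ (H : Type u) (_ : NormedAddCommGroup H) (_ : InnerProductSpace ℂ H)
        (_ : CompleteSpace H) (T : CovariantTriple A H), T.IsStrict δ) ∧
    (∀ δ : A → A,
      (∃ φ : A →⋆ₙₐ[ℂ] A, ∀ a : A, φ a = δ a) ↔
        ∃ (H : Type u) (_ : NormedAddCommGroup H) (_ : InnerProductSpace ℂ H)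
          (_ : CompleteSpace H) (T : CovariantTriple A H), T.CR1 δ ∧ T.CR2 δ) := by
  refine ⟨fun δ => ?_, fun δ => ⟨?_, ?_⟩⟩
  · obtain ⟨H, _, _, _, T, hT, -⟩ := exists_isStrict δ
    exact ⟨H, _, _, _, T, hT⟩
  · rintro ⟨φ, hφ⟩
    obtain rfl : ⇑φ = δ := funext hφ
    obtain ⟨H, _, _, _, T, hT, hCR1⟩ := exists_isStrict φ
    exact ⟨H, _, _, _, T, hCR1, hT.2⟩
  · rintro ⟨H, _, _, _, T, h1, h2⟩
    exact T.exists_starAlgHom h1 h2
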